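/- Let $N\ge 1$ be an integer, let $\mu_N\subset\mathbb C$ be the group of $N$-th roots of unity, and let $\alpha\in\mathbb Z/N\mathbb Z$. An index is a finite (possibly empty) sequence $\binom{\boldsymbol\eta}{\boldsymbol k}=\binom{\eta_1,\dots,\eta_r}{k_1,\dots,k_r}$ with $\eta_j\in\mu_N$ and $k_j\in\mathbb Z_{>0}$. **Harmonic algebra.** Let $\mathfrak A^1$ be the $\mathbb Q$-vector space with basis the words $e_{k_1,\eta_1}\cdots e_{k_r,\eta_r}$ ($r\ge0$) in the letters $e_{k,\eta}$ ($k\ge1$, $\eta\in\mu_N$), the empty word being denoted $1$ (that is, the non-commutative polynomial algebra freely generated by the $e_{k,\eta}$). The harmonic product $\ast$ on $\mathfrak A^1$ is the $\mathbb Q$-bilinear product given by $1\ast w=w\ast1=w$ and $$e_{k,\eta}w\ast e_{l,\xi}w'=e_{k,\eta}(w\ast e_{l,\xi}w')+e_{l,\xi}(e_{k,\eta}w\ast w')+e_{k+l,\eta\xi}(w\ast w');$$ it makes $\mathfrak A^1$ a commutative $\mathbb Q$-algebra $\mathfrak A^1_\ast$. **Symmetric values.** For $m\ge1$ put $L_m\binom{\boldsymbol\eta}{\boldsymbol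 k}=\sum_{m>m_1>\cdots>m_r>0}\frac{\eta_1^{m_1}\cdots\eta_r^{m_r}}{m_1^{k_1}\cdots m_r^{k_r}}$ (equal to $1$ for the empty index), and let $L_\ast\left(\begin{smallmatrix}\boldsymbol\eta\\ \boldsymbol k\end{smallmatrix};T\right)\in\mathbb C[T]$ be the unique polynomial with $L_m\binom{\boldsymbol\eta}{\boldsymbol k}=L_\ast\left(\begin{smallmatrix}\boldsymbol\eta\\ \boldsymbol k\end{smallmatrix};\log m+\gamma\right)+O\left(\frac{\log^Jm}{m}\right)$ as $m\to\infty$ for some positive integer $J$, where $\gamma$ is Euler's constant. The symmetric colored multiple zeta value $L^{\mathcal S}_\alpha\binom{\boldsymbol\eta}{\boldsymbol k}$ is the polynomial in $T$ $$\sum_{j=0}^r(-1)^{k_1+\cdots+k_j}(\eta_1\cdots\eta_j)^\alpha\,L_\ast\left(\begin{smallmatrix}\overline{\eta}_j,\dots,\overline{\eta}_1\\ k_j,\dots,k_1\end{smallmatrix};T+\tfrac{\pi i}{2}\right)L_\ast\left(\begin{smallmatrix}\eta_{j+1},\dots,\eta_r\\ k_{j+1},\dots,k_r\end{smallmatrix};T-\tfrac{\pi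 i}{2}\right)\in\mathbb C[T].$$ **Finite values.** Let $\mathcal P(N;\alpha)$ be the set of primes congruent to $\alpha$ modulo $N$ and put $\mathcal A(\alpha)=\prod_{p\in\mathcal P(N;\alpha)}\overline{\mathbb F}_p\big/\bigoplus_{p\in\mathcal P(N;\alpha)}\overline{\mathbb F}_p$, with the $\mathbb Q$-algebra structure sending $a\in\mathbb Q$ to the class of $(a\bmod p)_p$ (with component $0$ when $p$ divides the denominator of $a$); this ring is zero when $\alpha\notin(\mathbb Z/N\mathbb Z)^\times$. For each $p\in\mathcal P(N;\alpha)$ choose any prime ideal $\mathfrak P$ of $\mathbb Z[\zeta_{pN}]$ above the prime ideal $(1-\zeta_p)$ of $\mathbb Z[\zeta_p]$ and any embedding $\mathbb Z[\zeta_{pN}]/\mathfrak P\hookrightarrow\overline{\mathbb F}_p$. The finite colored multiple zeta value is $$L^{\mathcal A}_\alpha\binom{\boldsymbol\eta}{\boldsymbol k}=\left(\sum_{p>m_1>\cdots>m_r>0}\frac{\eta_1^{m_1}\cdots\eta_r^{m_r}}{m_1^{k_1}\cdots m_r^{k_r}}\bmod\mathfrak P\right)_{p\in\mathcal P(N;\alpha)}\in\mathcal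 A(\alpha).$$ **Proposition.** Every $L^{\mathcal S}_\alpha\binom{\boldsymbol\eta}{\boldsymbol k}$ is a constant polynomial, i.e. a complex number, and the $\mathbb Q$-linear maps $\mathcal L^{\mathcal S}_\alpha:\mathfrak A^1_\ast\to\mathbb C$ and $\mathcal L^{\mathcal A}_\alpha:\mathfrak A^1_\ast\to\mathcal A(\alpha)$ defined by $$\mathcal L^{\bullet}_\alpha(e_{k_1,\eta_1}\cdots e_{k_r,\eta_r})=L^{\bullet}_\alpha\binom{\eta_1,\dots,\eta_r}{k_1,\dots,k_r},\qquad \mathcal L^{\bullet}_\alpha(1)=1\qquad(\bullet\in\{\mathcal S,\mathcal A\})$$ are homomorphisms of $\mathbb Q$-algebras; that is, $\mathcal L^\bullet_\alpha(w)\,\mathcal L^\bullet_\alpha(w')=\mathcal L^\bullet_\alpha(w\ast w')$ for all $w,w'\in\mathfrak A^1_\ast$. -/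

import Mathlib

open scoped Polynomial

noncomputable section

namespace CMZV

/-! ### Words and the harmonic algebra -/

/-- The letter `e_{k,η}` (`k ≥ 1`, `η` an `N`-th root of unity in `ℂ`) is the pair `(k, η)`. -/
abbrev Letter (N : ℕ) : Type := ℕ+ × rootsOfUnity N ℂ

/-- The letter `e_{k+l,ηξ}` attached to `e_{k,η}` and `e_{l,ξ}`. -/
def Letter.merge {N : ℕ} (a b : Letter N) : Letter N := (a.1 + b.1, a.2 * b.2)

/-- The rational vector space `𝔄¹` with basis the words `e_{k₁,η₁} ⋯ e_{k_r,η_r}`, i.e. the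
underlying space of the non-commutative polynomial algebra freely generated by the `e_{k,η}`.
It is equipped below with the harmonic product, not with concatenation. -/
def HarmonicAlgebra (N : ℕ) : Type := List (Letter N) →₀ ℚ

namespace HarmonicAlgebra

variable {N : ℕ}

instance : AddCommGroup (HarmonicAlgebra N) :=
  inferInstanceAs (AddCommGroup (List (Letter N) →₀ ℚ))

instance : Module ℚ (HarmonicAlgebra N) :=
  inferInstanceAs (Module ℚ (List (Letter N) →₀ ℚ))

/-- The basis vector attached to a word. -/
def word (w : List (Letter N)) : HarmonicAlgebra N := Finsupp.single w (1 : ℚ)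

/-- The linear extension to `𝔄¹` of a function on words. -/
def lift {M : Type} [AddCommGroup M] [Module ℚ M] (f : List (Letter N) → M) :
    HarmonicAlgebra N →ₗ[ℚ] M :=
  Finsupp.linearCombination ℚ f

theorem lift_word {M : Type} [AddCommGroup M] [Module ℚ M] (f : List (Letter N) → M)
    (w : List (Letter N)) : lift f (word w) = f w := by
  have h := Finsupp.linearCombination_single ℚ (v := f) (1 : ℚ) w
  rw [one_smul] at h
  exact h

theorem hom_ext {M : Type} [AddCommGroup M] [Module ℚ M] {f g : HarmonicAlgebra N →ₗ[ℚ] M}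
    (h : ∀ w, f (word w) = g (word w)) : f = g :=
  Finsupp.lhom_ext' (fun w => LinearMap.ext_ring (h w))

/-- Left concatenation `p ↦ e_{k,η} p` with a letter. -/
def cons (a : Letter N) : HarmonicAlgebra N →ₗ[ℚ] HarmonicAlgebra N :=
  lift (fun w => word (a :: w))

theorem cons_word (a : Letter N) (w : List (Letter N)) : cons a (word w) = word (a :: w) :=
  lift_word _ _

/-- The harmonic product of two words. -/
def stuffle : List (Letter N) → List (Letter N) → HarmonicAlgebra N
  | [], w' => word w'
  | a :: w, [] => word (a :: w)
  | a :: w, b :: w' =>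
      cons a (stuffle w (b :: w')) + cons b (stuffle (a :: w) w') +
        cons (a.merge b) (stuffle w w')
termination_by w w' => w.length + w'.length

/-- The harmonic product on `𝔄¹`, as a bilinear map. -/
def harmonicMul : HarmonicAlgebra N →ₗ[ℚ] HarmonicAlgebra N →ₗ[ℚ] HarmonicAlgebra N :=
  lift (fun w => lift (fun w' => stuffle w w'))

instance : Mul (HarmonicAlgebra N) := ⟨fun p q => harmonicMul p q⟩

instance : One (HarmonicAlgebra N) := ⟨word []⟩

theorem mul_def (p q : HarmonicAlgebra N) : p * q = harmonicMul p q := rfl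

theorem one_def : (1 : HarmonicAlgebra N) = word [] := rfl

theorem word_mul_word (w w' : List (Letter N)) : word w * word w' = stuffle w w' := by
  rw [mul_def, harmonicMul, lift_word, lift_word]

theorem stuffle_nil (w : List (Letter N)) : stuffle w [] = word w := by
  cases w <;> simp [stuffle]

@[elab_as_elim]
theorem induction_words {P : HarmonicAlgebra N → Prop} (p : HarmonicAlgebra N)
    (h0 : P 0) (hadd : ∀ p q, P p → P q → P (p + q)) (hsmul : ∀ (c : ℚ) p, P p → P (c • p))
    (hw : ∀ w, P (word w)) : P p := by
  refine Finsupp.induction_linear (motive := P) p h0 (fun f g => hadd f g) (fun w c => ?_)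
  have h := hsmul c _ (hw w)
  have e : c • word w = (Finsupp.single w c : List (Letter N) →₀ ℚ) := by
    change c • (Finsupp.single w (1 : ℚ) : List (Letter N) →₀ ℚ) = _
    rw [Finsupp.smul_single, smul_eq_mul, mul_one]
  rw [e] at h
  exact h

theorem harm_add_mul (p q r : HarmonicAlgebra N) : (p + q) * r = p * r + q * r := by
  simp only [mul_def, map_add, LinearMap.add_apply]

theorem harm_mul_add (p q r : HarmonicAlgebra N) : p * (q + r) = p * q + p * r := by
  simp only [mul_def, map_add]

theorem harm_smul_mul (c : ℚ) (p q : HarmonicAlgebra N) : (c • p) * q = c • (p * q) := by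
  simp only [mul_def, map_smul, LinearMap.smul_apply]

theorem harm_mul_smul (c : ℚ) (p q : HarmonicAlgebra N) : p * (c • q) = c • (p * q) := by
  simp only [mul_def, map_smul]

theorem harm_zero_mul (p : HarmonicAlgebra N) : 0 * p = 0 := by
  simp only [mul_def, map_zero, LinearMap.zero_apply]

theorem harm_mul_zero (p : HarmonicAlgebra N) : p * 0 = 0 := by
  simp only [mul_def, map_zero]

theorem harm_one_mul (p : HarmonicAlgebra N) : 1 * p = p := by
  refine induction_words p (harm_mul_zero _) (fun p q hp hq => ?_) (fun c p hp => ?_) (fun w => ?_)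
  · rw [harm_mul_add, hp, hq]
  · rw [harm_mul_smul, hp]
  · rw [one_def, word_mul_word, stuffle]

theorem harm_mul_one (p : HarmonicAlgebra N) : p * 1 = p := by
  refine induction_words p (harm_zero_mul _) (fun p q hp hq => ?_) (fun c p hp => ?_) (fun w => ?_)
  · rw [harm_add_mul, hp, hq]
  · rw [harm_smul_mul, hp]
  · rw [one_def, word_mul_word, stuffle_nil]

/-- The recursion of the harmonic product, for arbitrary elements. -/
theorem cons_mul_cons (a b : Letter N) (p q : HarmonicAlgebra N) :
    cons a p * cons b q =
      cons a (p * cons b q) + cons b (cons a p * q) + cons (a.merge b) (p * q) := by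
  refine induction_words p ?_ (fun p p' hp hp' => ?_) (fun c p hp => ?_) (fun w => ?_)
  · simp only [map_zero, harm_zero_mul, add_zero]
  · simp only [map_add, harm_add_mul, hp, hp']
    abel
  · simp only [map_smul, harm_smul_mul, hp, smul_add]
  refine induction_words q ?_ (fun p p' hp hp' => ?_) (fun c p hp => ?_) (fun w' => ?_)
  · simp only [map_zero, harm_mul_zero, add_zero]
  · simp only [map_add, harm_mul_add, hp, hp']
    abel
  · simp only [map_smul, harm_mul_smul, hp, smul_add]
  · simp only [cons_word, word_mul_word]
    rw [stuffle]

theorem merge_comm (a b : Letter N) : a.merge b = b.merge a := by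
  simp only [Letter.merge, add_comm, mul_comm]

theorem merge_assoc (a b c : Letter N) : (a.merge b).merge c = a.merge (b.merge c) := by
  simp only [Letter.merge, add_assoc, mul_assoc]

theorem word_mul_comm (w w' : List (Letter N)) : word w * word w' = word w' * word w := by
  induction w generalizing w' with
  | nil => rw [← one_def, harm_one_mul, harm_mul_one]
  | cons a w ih =>
    induction w' with
    | nil => rw [← one_def, harm_one_mul, harm_mul_one]
    | cons b w' ih' =>
      have h1 := ih (b :: w')
      have h2 := ih w'
      simp only [← cons_word] at h1 h2 ih' ⊢
      rw [cons_mul_cons, cons_mul_cons, h1, h2, ih', merge_comm a b]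
      abel

theorem harm_mul_comm (p q : HarmonicAlgebra N) : p * q = q * p := by
  refine induction_words p ?_ (fun p p' hp hp' => ?_) (fun c p hp => ?_) (fun w => ?_)
  · rw [harm_mul_zero, harm_zero_mul]
  · rw [harm_mul_add, harm_add_mul, hp, hp']
  · rw [harm_mul_smul, harm_smul_mul, hp]
  refine induction_words q ?_ (fun p p' hp hp' => ?_) (fun c p hp => ?_) (fun w' => ?_)
  · rw [harm_mul_zero, harm_zero_mul]
  · rw [harm_mul_add, harm_add_mul, hp, hp']
  · rw [harm_mul_smul, harm_smul_mul, hp]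
  · exact word_mul_comm w w'

theorem word_mul_assoc (u v w : List (Letter N)) :
    word u * word v * word w = word u * (word v * word w) := by
  induction u generalizing v w with
  | nil => rw [← one_def, harm_one_mul, harm_one_mul]
  | cons a u ihu =>
    induction v generalizing w with
    | nil => rw [← one_def, harm_one_mul, harm_mul_one]
    | cons b v ihv =>
      induction w with
      | nil => rw [← one_def, harm_mul_one, harm_mul_one]
      | cons c w ihw =>
        have h1 := ihu (b :: v) (c :: w)
        have h2 := ihu (b :: v) w
        have h3 := ihu v (c :: w)
        have h4 := ihu v w
        have h5 := ihv (c :: w)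
        have h6 := ihv w
        simp only [← cons_word] at h1 h2 h3 h4 h5 h6 ihw ⊢
        have hL : cons a (word u) * cons b (word v) * cons c (word w) =
            cons a (word u * (cons b (word v) * cons c (word w)))
              + cons b (cons a (word u) * (word v * cons c (word w)))
              + cons (a.merge b) (word u * (word v * cons c (word w)))
              + cons c (cons a (word u) * cons b (word v) * word w)
              + cons (a.merge c) (word u * (cons b (word v) * word w))
              + cons (b.merge c) (cons a (word u) * (word v * word w))
              + cons ((a.merge b).merge c) (word u * (word v * word w)) := by
          rw [← h1, ← h2, ← h3, ← h4, ← h5, ← h6, cons_mul_cons a b]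
          simp only [harm_add_mul, cons_mul_cons, map_add]
          abel
        have hR : cons a (word u) * (cons b (word v) * cons c (word w)) =
            cons a (word u * (cons b (word v) * cons c (word w)))
              + cons b (cons a (word u) * (word v * cons c (word w)))
              + cons (a.merge b) (word u * (word v * cons c (word w)))
              + cons c (cons a (word u) * (cons b (word v) * word w))
              + cons (a.merge c) (word u * (cons b (word v) * word w))
              + cons (b.merge c) (cons a (word u) * (word v * word w))
              + cons (a.merge (b.merge c)) (word u * (word v * word w)) := by
          rw [cons_mul_cons b c]
          simp only [harm_mul_add, cons_mul_cons a, map_add]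
          abel
        rw [hL, hR, ihw, merge_assoc]

theorem harm_mul_assoc (p q r : HarmonicAlgebra N) : p * q * r = p * (q * r) := by
  refine induction_words p ?_ (fun p p' hp hp' => ?_) (fun c p hp => ?_) (fun u => ?_)
  · simp only [harm_zero_mul]
  · simp only [harm_add_mul, hp, hp']
  · simp only [harm_smul_mul, hp]
  refine induction_words q ?_ (fun p p' hp hp' => ?_) (fun c p hp => ?_) (fun v => ?_)
  · simp only [harm_zero_mul, harm_mul_zero]
  · simp only [harm_add_mul, harm_mul_add, hp, hp']
  · simp only [harm_smul_mul, harm_mul_smul, hp]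
  refine induction_words r ?_ (fun p p' hp hp' => ?_) (fun c p hp => ?_) (fun w => ?_)
  · simp only [harm_mul_zero]
  · simp only [harm_mul_add, hp, hp']
  · simp only [harm_mul_smul, hp]
  · exact word_mul_assoc u v w

/-- The commutative ring `𝔄¹_*`: the space `𝔄¹` with the harmonic product. -/
instance : CommRing (HarmonicAlgebra N) where
  __ := (inferInstance : AddCommGroup (HarmonicAlgebra N))
  left_distrib := harm_mul_add
  right_distrib := harm_add_mul
  zero_mul := harm_zero_mul
  mul_zero := harm_mul_zero
  mul_assoc := harm_mul_assoc
  one_mul := harm_one_mul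
  mul_one := harm_mul_one
  mul_comm := harm_mul_comm

instance : Algebra ℚ (HarmonicAlgebra N) := Algebra.ofModule harm_smul_mul harm_mul_smul

end HarmonicAlgebra

/-! ### Truncated colored multiple zeta values and harmonic regularization -/

/-- For a field `K` and a character `χ` of the group of `N`-th roots of unity with values in `K`,
the nested sum `∑_{m > m₁ > ⋯ > m_r > 0} ∏_j χ(η_j)^{m_j} / m_j^{k_j}` in `K`
(equal to `1` for the empty index). -/
def truncSum {N : ℕ} {K : Type} [Field K] (χ : rootsOfUnity N ℂ →* K) :
    List (Letter N) → ℕ → K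
  | [], _ => 1
  | a :: w, m =>
      ∑ n ∈ Finset.Ico 1 m, χ a.2 ^ n / (n : K) ^ (a.1 : ℕ) * truncSum χ w n

/-- The inclusion of the `N`-th roots of unity into `ℂ`. -/
def rootsIncl (N : ℕ) : rootsOfUnity N ℂ →* ℂ :=
  (Units.coeHom ℂ).comp (rootsOfUnity N ℂ).subtype

/-- The truncated colored multiple zeta value `L_m`. -/
def truncL {N : ℕ} (w : List (Letter N)) (m : ℕ) : ℂ := truncSum (rootsIncl N) w m

/-- `P` is a harmonic regularization polynomial of the index `w`:
`L_m(w) = P(log m + γ) + O(log^J m / m)` as `m → ∞` for some positive integer `J`. -/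
def IsHarmonicReg {N : ℕ} (w : List (Letter N)) (P : ℂ[X]) : Prop :=
  ∃ J : ℕ, 0 < J ∧
    (fun m : ℕ => truncL w m -
        P.eval ((Real.log m + Real.eulerMascheroniConstant : ℝ) : ℂ))
      =O[Filter.atTop] (fun m : ℕ => Real.log m ^ J / (m : ℝ))

/-- The harmonic regularized colored multiple zeta value `L_*(w; T) ∈ ℂ[T]`: the unique polynomial
with the asymptotic property `IsHarmonicReg`. -/
def regL {N : ℕ} (w : List (Letter N)) : ℂ[X] := Classical.epsilon (IsHarmonicReg w)

/-! ### Symmetric colored multiple zeta values -/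

/-- The index with reversed order and each root of unity replaced by its complex conjugate
(which is its inverse). -/
def revConj {N : ℕ} (w : List (Letter N)) : List (Letter N) :=
  (w.map fun a => (a.1, a.2⁻¹)).reverse

/-- The weight `k₁ + ⋯ + k_r`. -/
def weight {N : ℕ} (w : List (Letter N)) : ℕ := (w.map fun a => (a.1 : ℕ)).sum

/-- The product `η₁ ⋯ η_r`. -/
def colorProd {N : ℕ} (w : List (Letter N)) : rootsOfUnity N ℂ := (w.map Prod.snd).prod

/-- The symmetric colored multiple zeta value `L^S_α(w; T)` as a polynomial in `T`. -/
def symL {N : ℕ} (α : ZMod N) (w : List (Letter N)) : ℂ[X] :=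
  ∑ j ∈ Finset.range (w.length + 1),
    Polynomial.C ((-1) ^ weight (w.take j) * rootsIncl N (colorProd (w.take j)) ^ α.val) *
      (regL (revConj (w.take j))).comp
        (Polynomial.X + Polynomial.C ((Real.pi : ℂ) * Complex.I / 2)) *
      (regL (w.drop j)).comp
        (Polynomial.X - Polynomial.C ((Real.pi : ℂ) * Complex.I / 2))

/-! ### The ring `𝒜(α)` and finite colored multiple zeta values -/

/-- The set of primes congruent to `α` modulo `N`. -/
def primesInClass (N : ℕ) (α : ZMod N) : Set ℕ := {p | p.Prime ∧ (p : ZMod N) = α}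

instance {N : ℕ} {α : ZMod N} (p : primesInClass N α) : Fact (p : ℕ).Prime := ⟨p.2.1⟩

/-- The product of the fields `𝔽̄_p` over the primes `p ≡ α mod N`. -/
abbrev ResidueProduct (N : ℕ) (α : ZMod N) : Type :=
  ∀ p : primesInClass N α, AlgebraicClosure (ZMod (p : ℕ))

/-- The direct sum of the `𝔽̄_p`, as an ideal of their product. -/
def finiteSupportIdeal (N : ℕ) (α : ZMod N) : Ideal (ResidueProduct N α) where
  carrier := {a | {p | a p ≠ 0}.Finite}
  zero_mem' := by simp
  add_mem' := by
    intro a b ha hb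
    refine (Set.Finite.union ha hb).subset fun p hp => ?_
    by_contra hc
    simp only [Set.mem_union, Set.mem_ofPred_eq, not_or, not_not] at hc
    exact hp (by rw [Pi.add_apply, hc.1, hc.2, add_zero])
  smul_mem' := by
    intro c a ha
    refine Set.Finite.subset ha fun p hp hc => hp ?_
    rw [smul_eq_mul, Pi.mul_apply, hc, mul_zero]

/-- The ring `𝒜(α) = ∏_p 𝔽̄_p / ⨁_p 𝔽̄_p`, over the primes `p ≡ α mod N`. -/
abbrev FiniteRing (N : ℕ) (α : ZMod N) : Type :=
  ResidueProduct N α ⧸ finiteSupportIdeal N α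

theorem finite_cast_eq_zero {N : ℕ} {α : ZMod N} (n : ℕ) (hn : n ≠ 0) :
    {p : primesInClass N α | ((n : ℕ) : AlgebraicClosure (ZMod (p : ℕ))) = 0}.Finite := by
  refine Set.Finite.of_finite_image (f := fun p : primesInClass N α => (p : ℕ))
    ((Nat.divisors n).finite_toSet.subset ?_) (Subtype.val_injective.injOn)
  rintro _ ⟨p, hp, rfl⟩
  simp only [Finset.mem_coe, Nat.mem_divisors]
  exact ⟨(CharP.cast_eq_zero_iff (AlgebraicClosure (ZMod (p : ℕ))) (p : ℕ) n).1 hp, hn⟩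

theorem mk_eq_of_finite {N : ℕ} {α : ZMod N} {a b : ResidueProduct N α} (n : ℕ) (hn : n ≠ 0)
    (h : ∀ p : primesInClass N α, ((n : ℕ) : AlgebraicClosure (ZMod (p : ℕ))) ≠ 0 → a p = b p) :
    Ideal.Quotient.mk (finiteSupportIdeal N α) a = Ideal.Quotient.mk _ b := by
  rw [Ideal.Quotient.eq]
  refine (finite_cast_eq_zero n hn).subset fun p hp => ?_
  by_contra hc
  exact hp (by rw [Pi.sub_apply, h p hc, sub_self])

/-- The embedding of `ℚ` into `𝒜(α)`: the `p`-component of the image of `x` is the residue of `x`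
(and `0` for the finitely many `p` that divide the denominator). -/
def ratEmbedding (N : ℕ) (α : ZMod N) : ℚ →+* FiniteRing N α where
  toFun x := Ideal.Quotient.mk _ (fun p => (x : AlgebraicClosure (ZMod (p : ℕ))))
  map_one' := by
    rw [← map_one (Ideal.Quotient.mk (finiteSupportIdeal N α))]
    congr 1
    funext p
    exact Rat.cast_one
  map_zero' := by
    rw [← map_zero (Ideal.Quotient.mk (finiteSupportIdeal N α))]
    congr 1
    funext p
    exact Rat.cast_zero
  map_add' x y := by
    rw [← map_add]
    refine mk_eq_of_finite (x.den * y.den) (mul_ne_zero x.den_ne_zero y.den_ne_zero)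
      fun p hp => ?_
    rw [Nat.cast_mul] at hp
    exact Rat.cast_add_of_ne_zero (left_ne_zero_of_mul hp) (right_ne_zero_of_mul hp)
  map_mul' x y := by
    rw [← map_mul]
    refine mk_eq_of_finite (x.den * y.den) (mul_ne_zero x.den_ne_zero y.den_ne_zero)
      fun p hp => ?_
    rw [Nat.cast_mul] at hp
    exact Rat.cast_mul_of_ne_zero (left_ne_zero_of_mul hp) (right_ne_zero_of_mul hp)

instance (N : ℕ) (α : ZMod N) : Algebra ℚ (FiniteRing N α) := (ratEmbedding N α).toAlgebra

/-- The ring `ℤ[ζ_n]`, as a subring of `ℂ`. -/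
def cyclotomicIntegers (n : ℕ) : Subalgebra ℤ ℂ := Algebra.adjoin ℤ {z : ℂ | z ^ n = 1}

theorem cyclotomicIntegers_mono {m n : ℕ} (h : m ∣ n) :
    cyclotomicIntegers m ≤ cyclotomicIntegers n := by
  refine Algebra.adjoin_mono fun z hz => ?_
  obtain ⟨k, rfl⟩ := h
  simp only [Set.mem_ofPred_eq] at hz ⊢
  rw [pow_mul, hz, one_pow]

/-- A choice of a prime ideal `𝔓` of `ℤ[ζ_{pN}]` above the prime ideal `(1 - ζ_p)` of `ℤ[ζ_p]`,
and of an embedding of the residue ring `ℤ[ζ_{pN}]/𝔓` into `𝔽̄_p`. -/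
structure ResidueChoice (N p : ℕ) [Fact p.Prime] where
  ideal : Ideal (cyclotomicIntegers (p * N))
  isPrime : ideal.IsPrime
  liesAbove : ∀ ζ : cyclotomicIntegers p, IsPrimitiveRoot ζ p →
    ideal.comap (Subalgebra.inclusion (cyclotomicIntegers_mono (Dvd.intro N rfl))) =
      Ideal.span {1 - ζ}
  embedding : (cyclotomicIntegers (p * N) ⧸ ideal) →+* AlgebraicClosure (ZMod p)

/-- An `N`-th root of unity as an element of `ℤ[ζ_{pN}]`. -/
def rootsToIntegers (N p : ℕ) : rootsOfUnity N ℂ →* cyclotomicIntegers (p * N) where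
  toFun η := ⟨rootsIncl N η, Algebra.subset_adjoin (by
    have h : (η : ℂˣ) ^ N = 1 := η.2
    have h' : rootsIncl N η ^ N = 1 := by
      change ((η : ℂˣ) : ℂ) ^ N = 1
      rw [← Units.val_pow_eq_pow_val, h, Units.val_one]
    change rootsIncl N η ^ (p * N) = 1
    rw [mul_comm, pow_mul, h', one_pow])⟩
  map_one' := Subtype.ext (map_one (rootsIncl N))
  map_mul' η ξ := Subtype.ext (map_mul (rootsIncl N) η ξ)

/-- Reduction of `N`-th roots of unity modulo `𝔓`, with values in `𝔽̄_p`. -/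
def ResidueChoice.reduce {N p : ℕ} [Fact p.Prime] (c : ResidueChoice N p) :
    rootsOfUnity N ℂ →* AlgebraicClosure (ZMod p) :=
  ((c.embedding.comp (Ideal.Quotient.mk c.ideal) :
      cyclotomicIntegers (p * N) →+* AlgebraicClosure (ZMod p)) :
      cyclotomicIntegers (p * N) →* AlgebraicClosure (ZMod p)).comp (rootsToIntegers N p)

/-- The finite colored multiple zeta value `L^A_α(w)`: its `p`-component is the reduction modulo
`𝔓` of `L_p(w)`. The denominators of `L_p(w)` are prime to `p`, so the reduction is the same nested
sum computed in `𝔽̄_p` with the reduced roots of unity. -/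
def finL {N : ℕ} {α : ZMod N} (c : ∀ p : primesInClass N α, ResidueChoice N (p : ℕ))
    (w : List (Letter N)) : FiniteRing N α :=
  Ideal.Quotient.mk _ (fun p => truncSum (c p).reduce w (p : ℕ))

end CMZV

end

noncomputable section

namespace CMZV

/-! ### Multiplicative functions on words -/

/-! Both maps are assembled from characters of the harmonic algebra. For a character χ of `μ_N` with
values in a field and a fixed m, the truncated sums multiply by the harmonic product
(`truncSum_mul`): in a product of two nested sums, either one of the two outermost indices is larger
or they coincide, and these are the three terms of the recursion. With m = p and χ the reduction
modulo 𝔓, componentwise, this is already the finite case.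

For the symmetric case, partial summation shows that L_* exists (`IsHarmonicReg.exists_cons`). A
polynomial in log m + γ that is O(log^J m / m) vanishes (`eq_zero_of_logPowO_eval`), so L_* is
unique and inherits multiplicativity from the truncated sums (`regL_mul`). Reversal with conjugation
(`revConjHom`) and deconcatenation (`deconcat`) respect the harmonic product, and the factor (-1)^k
η^α is multiplicative under merging of letters. The symmetric value is thus the convolution, along
deconcatenation, of two characters with values in ℂ[T], hence again a character (`symHom`).

It is constant because d/dT removes a leading e_{1,1} from L_* and kills every word with another
first letter (`derivative_regL_cons`). In the derivative of the symmetric sum each letter e_{1,1} is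
removed once from the left factor and once from the right one, with opposite signs
(`derivative_symL`). Evaluation at T = 0 then loses nothing. -/

/-- The words occurring in the harmonic product of two words, with multiplicity. -/
def stuffleList {N : ℕ} : List (Letter N) → List (Letter N) → List (List (Letter N))
  | [], w' => [w']
  | a :: w, [] => [a :: w]
  | a :: w, b :: w' =>
      (stuffleList w (b :: w')).map (List.cons a) ++
        ((stuffleList (a :: w) w').map (List.cons b) ++
          (stuffleList w w').map (List.cons (a.merge b)))
termination_by w w' => w.length + w'.length

theorem map_sum_word_cons {N : ℕ} (a : Letter N) (l : List (List (Letter N))) :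
    ((l.map (List.cons a)).map HarmonicAlgebra.word).sum =
      HarmonicAlgebra.cons a (l.map HarmonicAlgebra.word).sum := by
  rw [map_list_sum, List.map_map, List.map_map]
  congr 1
  refine List.map_congr_left fun v _ => ?_
  simp [HarmonicAlgebra.cons_word]

/-- The coefficients of a product of words are nonnegative integers, so multiplicativity of a
function on words can be stated as a finite sum over a list, without linear extension. This form
suits asymptotic and componentwise arguments. -/
theorem stuffle_eq_sum {N : ℕ} (w w' : List (Letter N)) :
    HarmonicAlgebra.stuffle w w' = ((stuffleList w w').map HarmonicAlgebra.word).sum := by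
  induction w, w' using stuffleList.induct with
  | case1 w' => simp [stuffleList, HarmonicAlgebra.stuffle]
  | case2 a w => simp [stuffleList, HarmonicAlgebra.stuffle]
  | case3 a w b w' h1 h2 h3 =>
    rw [stuffleList, HarmonicAlgebra.stuffle, h1, h2, h3]
    simp only [List.map_append, List.sum_append, map_sum_word_cons, add_assoc]

namespace HarmonicAlgebra

theorem map_mul_of_map_word_mul_word {N : ℕ} {M : Type} [CommRing M] [Algebra ℚ M]
    (F : HarmonicAlgebra N →ₗ[ℚ] M)
    (h : ∀ u v : List (Letter N), F (word u * word v) = F (word u) * F (word v))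
    (p q : HarmonicAlgebra N) : F (p * q) = F p * F q := by
  refine induction_words p (by simp) (fun p p' hp hp' => ?_)
    (fun c p hp => ?_) (fun w => ?_)
  · rw [add_mul, map_add, hp, hp', map_add, add_mul]
  · rw [smul_mul_assoc, map_smul, hp, map_smul, smul_mul_assoc]
  refine induction_words q (by simp) (fun p p' hp hp' => ?_)
    (fun c p hp => ?_) (fun w' => h w w')
  · rw [mul_add, map_add, hp, hp', map_add, mul_add]
  · rw [mul_smul_comm, map_smul, hp, map_smul, mul_smul_comm]

end HarmonicAlgebra

/-- The algebra homomorphism on the harmonic algebra attached to a multiplicative function on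
words. -/
def algHomOfWords {N : ℕ} {M : Type} [CommRing M] [Algebra ℚ M] (f : List (Letter N) → M)
    (h1 : f [] = 1) (hmul : ∀ w w', f w * f w' = ((stuffleList w w').map f).sum) :
    HarmonicAlgebra N →ₐ[ℚ] M :=
  AlgHom.ofLinearMap (HarmonicAlgebra.lift f)
    (by rw [HarmonicAlgebra.one_def, HarmonicAlgebra.lift_word, h1])
    (HarmonicAlgebra.map_mul_of_map_word_mul_word _ fun w w' => by
      rw [HarmonicAlgebra.word_mul_word, stuffle_eq_sum, map_list_sum, List.map_map,
        HarmonicAlgebra.lift_word, HarmonicAlgebra.lift_word, hmul]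
      congr 1
      exact List.map_congr_left fun v _ => HarmonicAlgebra.lift_word f v)

theorem algHomOfWords_word {N : ℕ} {M : Type} [CommRing M] [Algebra ℚ M]
    (f : List (Letter N) → M) (h1 : f [] = 1)
    (hmul : ∀ w w', f w * f w' = ((stuffleList w w').map f).sum) (w : List (Letter N)) :
    algHomOfWords f h1 hmul (HarmonicAlgebra.word w) = f w :=
  HarmonicAlgebra.lift_word f w

theorem algHom_word_mul {N : ℕ} {M : Type} [CommRing M] [Algebra ℚ M]
    (F : HarmonicAlgebra N →ₐ[ℚ] M) (w w' : List (Letter N)) :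
    F (HarmonicAlgebra.word w) * F (HarmonicAlgebra.word w') =
      ((stuffleList w w').map fun v => F (HarmonicAlgebra.word v)).sum := by
  rw [← map_mul, HarmonicAlgebra.word_mul_word, stuffle_eq_sum, map_list_sum, List.map_map]
  rfl

/-- Each word of the product uses every letter of both factors once, possibly merged. Twisting a
character by such a τ therefore gives a character; the case needed is `symSign`. -/
theorem eq_mul_of_mem_stuffleList {N : ℕ} {M : Type} [CommMonoid M] (τ : Letter N → M)
    (hτ : ∀ a b, τ (a.merge b) = τ a * τ b) (w w' v : List (Letter N))
    (hv : v ∈ stuffleList w w') :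
    (v.map τ).prod = (w.map τ).prod * (w'.map τ).prod := by
  induction w, w' using stuffleList.induct generalizing v with
  | case1 w' =>
    simp only [stuffleList, List.mem_singleton] at hv
    simp [hv]
  | case2 a w =>
    simp only [stuffleList, List.mem_singleton] at hv
    simp [hv]
  | case3 a w b w' h1 h2 h3 =>
    rw [stuffleList] at hv
    simp only [List.mem_append, List.mem_map] at hv
    rcases hv with ⟨u, hu, rfl⟩ | ⟨u, hu, rfl⟩ | ⟨u, hu, rfl⟩
    · simp only [List.map_cons, List.prod_cons, h1 u hu]
      rw [mul_assoc]
    · simp only [List.map_cons, List.prod_cons, h2 u hu]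
      rw [mul_left_comm]
    · simp only [List.map_cons, List.prod_cons, h3 u hu, hτ]
      rw [mul_mul_mul_comm]

/-! ### Products of truncated sums -/

theorem truncSum_cons_succ {N : ℕ} {K : Type} [Field K] (χ : rootsOfUnity N ℂ →* K)
    (a : Letter N) (w : List (Letter N)) (m : ℕ) :
    truncSum χ (a :: w) (m + 1) =
      truncSum χ (a :: w) m + χ a.2 ^ m / (m : K) ^ (a.1 : ℕ) * truncSum χ w m := by
  rcases Nat.eq_zero_or_pos m with rfl | hm
  -- For m = 0 both ranges are empty, and the extra term has denominator 0 ^ k with k ≥ 1, so it is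
  -- 0 by convention.
  · simp [truncSum]
  · rw [truncSum, truncSum, Finset.sum_Ico_succ_top hm]

theorem sum_truncSum_cons_succ {N : ℕ} {K : Type} [Field K] (χ : rootsOfUnity N ℂ →* K)
    (a : Letter N) (l : List (List (Letter N))) (m : ℕ) :
    ((l.map (List.cons a)).map fun v => truncSum χ v (m + 1)).sum =
      ((l.map (List.cons a)).map fun v => truncSum χ v m).sum +
        χ a.2 ^ m / (m : K) ^ (a.1 : ℕ) * (l.map fun v => truncSum χ v m).sum := by
  induction l with
  | nil => simp
  | cons v l ih =>
    simp only [List.map_cons, List.sum_cons] at ih ⊢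
    rw [ih, truncSum_cons_succ]
    ring

/-- Induction on m, for all words at once. Passing from m to m + 1 turns the factors A, B into A +
xA', B + yB', where A', B' belong to the words without their first letters. The new terms xA'B,
yAB', xyA'B' are the increments of the three branches of the harmonic product. -/
theorem truncSum_mul {N : ℕ} {K : Type} [Field K] (χ : rootsOfUnity N ℂ →* K) (m : ℕ)
    (w w' : List (Letter N)) :
    truncSum χ w m * truncSum χ w' m =
      ((stuffleList w w').map fun v => truncSum χ v m).sum := by
  induction m generalizing w w' with
  | zero =>
    -- Sums of nonempty words vanish at m = 0, and every word in a product of nonempty words is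
    -- nonempty.
    have hz (a : Letter N) (l : List (List (Letter N))) :
        ((l.map (List.cons a)).map fun v => truncSum χ v 0).sum = 0 := by
      induction l with
      | nil => simp
      | cons v l ih => simp only [List.map_cons, List.sum_cons, ih]; simp [truncSum]
    cases w with
    | nil => simp [stuffleList, truncSum]
    | cons a w =>
      cases w' with
      | nil => simp [stuffleList, truncSum]
      | cons b w' =>
        rw [stuffleList]
        simp only [List.map_append, List.sum_append, hz]
        simp [truncSum]
  | succ m ih =>
    cases w with
    | nil => simp [stuffleList, truncSum]
    | cons a w =>
      cases w' with
      | nil => simp [stuffleList, truncSum]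
      | cons b w' =>
        have h0 := ih (a :: w) (b :: w')
        rw [stuffleList] at h0 ⊢
        simp only [List.map_append, List.sum_append] at h0 ⊢
        rw [sum_truncSum_cons_succ, sum_truncSum_cons_succ, sum_truncSum_cons_succ, ← ih, ← ih,
          ← ih, truncSum_cons_succ, truncSum_cons_succ]
        -- This also holds when m vanishes in K, so no condition on the characteristic is needed.
        have hm : χ (a.merge b).2 ^ m / (m : K) ^ ((a.merge b).1 : ℕ) =
            (χ a.2 ^ m / (m : K) ^ (a.1 : ℕ)) * (χ b.2 ^ m / (m : K) ^ (b.1 : ℕ)) := by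
          simp only [Letter.merge, map_mul, PNat.add_coe, pow_add, mul_pow]
          rw [div_mul_div_comm]
        rw [hm]
        linear_combination h0

/-! ### Finite colored multiple zeta values -/

theorem finL_mul {N : ℕ} {α : ZMod N} (c : ∀ p : primesInClass N α, ResidueChoice N (p : ℕ))
    (w w' : List (Letter N)) :
    finL c w * finL c w' = ((stuffleList w w').map (finL c)).sum := by
  have h : (stuffleList w w').map (finL c) =
      ((stuffleList w w').map fun v =>
        (fun p => truncSum (c p).reduce v (p : ℕ) : ResidueProduct N α)).map
          (Ideal.Quotient.mk (finiteSupportIdeal N α)) := by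
    rw [List.map_map]
    rfl
  rw [h, ← map_list_sum, finL, finL, ← map_mul]
  congr 1
  funext p
  rw [Pi.mul_apply, truncSum_mul]
  generalize stuffleList w w' = l
  induction l with
  | nil => rfl
  | cons v l ih => simp only [List.map_cons, List.sum_cons, Pi.add_apply, ih]

theorem finL_nil {N : ℕ} {α : ZMod N}
    (c : ∀ p : primesInClass N α, ResidueChoice N (p : ℕ)) : finL c [] = 1 := by
  rw [finL, ← map_one (Ideal.Quotient.mk (finiteSupportIdeal N α))]
  rfl

/-! ### Sequences bounded by powers of the logarithm -/

/-- `f n = O(log^J n / n^a)` for some positive integer `J`. -/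
def LogPowO (a : ℕ) (f : ℕ → ℂ) : Prop :=
  ∃ J : ℕ, 0 < J ∧ f =O[Filter.atTop] fun n : ℕ => Real.log n ^ J / (n : ℝ) ^ a

theorem eventually_le_log (c : ℝ) : ∀ᶠ n : ℕ in Filter.atTop, c ≤ Real.log n :=
  (Real.tendsto_log_atTop.comp tendsto_natCast_atTop_atTop).eventually_ge_atTop c

theorem isBigO_log_pow_div {a b J K : ℕ} (hJK : J ≤ K) (hba : b ≤ a) :
    (fun n : ℕ => Real.log n ^ J / (n : ℝ) ^ a) =O[Filter.atTop]
      fun n : ℕ => Real.log n ^ K / (n : ℝ) ^ b := by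
  refine Asymptotics.IsBigO.of_bound 1 ?_
  filter_upwards [eventually_le_log 1, Filter.eventually_ge_atTop 1] with n hn hn1
  have h1 : (1 : ℝ) ≤ n := by exact_mod_cast hn1
  have h0 : (0 : ℝ) ≤ Real.log n := zero_le_one.trans hn
  rw [one_mul, Real.norm_of_nonneg (by positivity), Real.norm_of_nonneg (by positivity)]
  have := pow_le_pow_right₀ hn hJK
  have := pow_le_pow_right₀ h1 hba
  gcongr

theorem LogPowO.mono {a b : ℕ} {f : ℕ → ℂ} (h : LogPowO a f) (hba : b ≤ a) : LogPowO b f := by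
  obtain ⟨J, hJ, h⟩ := h
  exact ⟨J, hJ, h.trans (isBigO_log_pow_div le_rfl hba)⟩

theorem LogPowO.congr' {a : ℕ} {f g : ℕ → ℂ} (h : LogPowO a f) (hfg : f =ᶠ[Filter.atTop] g) :
    LogPowO a g := by
  obtain ⟨J, hJ, h⟩ := h
  exact ⟨J, hJ, h.congr' hfg Filter.EventuallyEq.rfl⟩

theorem LogPowO.add {a : ℕ} {f g : ℕ → ℂ} (hf : LogPowO a f) (hg : LogPowO a g) :
    LogPowO a fun n => f n + g n := by
  obtain ⟨J, hJ, hf⟩ := hf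
  obtain ⟨K, hK, hg⟩ := hg
  exact ⟨J + K, by omega, (hf.trans (isBigO_log_pow_div (by omega) le_rfl)).add
    (hg.trans (isBigO_log_pow_div (by omega) le_rfl))⟩

theorem LogPowO.mul {a b : ℕ} {f g : ℕ → ℂ} (hf : LogPowO a f) (hg : LogPowO b g) :
    LogPowO (a + b) fun n => f n * g n := by
  obtain ⟨J, hJ, hf⟩ := hf
  obtain ⟨K, hK, hg⟩ := hg
  refine ⟨J + K, by omega, (hf.mul hg).congr_right fun n => ?_⟩
  rw [pow_add, pow_add, div_mul_div_comm]

theorem LogPowO.of_bound {a : ℕ} {f : ℕ → ℂ} (C : ℝ)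
    (h : ∀ᶠ n : ℕ in Filter.atTop, ‖f n‖ ≤ C * (1 / (n : ℝ) ^ a)) : LogPowO a f := by
  refine ⟨1, one_pos, Asymptotics.IsBigO.trans (g := fun n : ℕ => Real.log n ^ 0 / (n : ℝ) ^ a)
    (Asymptotics.IsBigO.of_bound C ?_) (isBigO_log_pow_div (Nat.zero_le 1) le_rfl)⟩
  filter_upwards [h] with n hn
  rw [pow_zero, Real.norm_of_nonneg (by positivity)]
  exact hn

theorem LogPowO.const (c : ℂ) : LogPowO 0 fun _ => c :=
  LogPowO.of_bound ‖c‖ (Filter.Eventually.of_forall fun n => by simp)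

theorem LogPowO.const_mul {a : ℕ} {f : ℕ → ℂ} (hf : LogPowO a f) (c : ℂ) :
    LogPowO a fun n => c * f n := by
  simpa using (LogPowO.const c).mul hf

theorem LogPowO.neg {a : ℕ} {f : ℕ → ℂ} (hf : LogPowO a f) : LogPowO a fun n => -f n := by
  simpa using hf.const_mul (-1)

theorem LogPowO.sub {a : ℕ} {f g : ℕ → ℂ} (hf : LogPowO a f) (hg : LogPowO a g) :
    LogPowO a fun n => f n - g n := by
  simpa [sub_eq_add_neg] using hf.add hg.neg

theorem logPowO_inv_pow (a : ℕ) : LogPowO a fun n => 1 / (n : ℂ) ^ a :=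
  LogPowO.of_bound 1 (Filter.Eventually.of_forall fun n => by simp)

theorem logPowO_inv : LogPowO 1 fun n => 1 / (n : ℂ) := by
  simpa using logPowO_inv_pow 1

theorem logPowO_inv_succ : LogPowO 1 fun n => 1 / ((n : ℂ) + 1) := by
  refine LogPowO.of_bound 1 ?_
  filter_upwards [Filter.eventually_ge_atTop 1] with n hn
  have h1 : (0 : ℝ) < n := by exact_mod_cast hn
  have : ‖(n : ℂ) + 1‖ = (n : ℝ) + 1 := by
    rw [← Nat.cast_succ, Complex.norm_natCast, Nat.cast_succ]
  rw [norm_div, norm_one, this, pow_one, one_mul]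
  gcongr
  linarith

theorem logPowO_inv_succ_sub_inv : LogPowO 2 fun n => 1 / ((n : ℂ) + 1) - 1 / (n : ℂ) := by
  refine (logPowO_inv_succ.mul logPowO_inv).neg.congr' ?_
  filter_upwards [Filter.eventually_ge_atTop 1] with n hn
  have h1 : (n : ℂ) ≠ 0 := by exact_mod_cast (by omega : n ≠ 0)
  have h2 : (n : ℂ) + 1 ≠ 0 := by exact_mod_cast (by omega : n + 1 ≠ 0)
  field_simp
  ring

/-! ### Increments of polynomials in log n + γ -/

/-- The sequence `log n + γ`. -/
def logGamma (n : ℕ) : ℂ := ((Real.log n + Real.eulerMascheroniConstant : ℝ) : ℂ)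

theorem logPowO_logGamma : LogPowO 0 logGamma := by
  have h : LogPowO 0 fun n : ℕ => ((Real.log n : ℝ) : ℂ) := by
    refine ⟨1, one_pos, Asymptotics.IsBigO.of_bound 1 (Filter.Eventually.of_forall fun n => ?_)⟩
    rw [Complex.norm_real, pow_one, pow_zero, div_one, one_mul]
  refine (h.add (LogPowO.const (Real.eulerMascheroniConstant : ℂ))).congr'
    (Filter.Eventually.of_forall fun n => ?_)
  simp [logGamma]

theorem logPowO_eval_logGamma (P : ℂ[X]) : LogPowO 0 fun n => P.eval (logGamma n) := by
  induction P using Polynomial.induction_on' with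
  | add p q hp hq => simpa using hp.add hq
  | monomial k a =>
    have h (k : ℕ) : LogPowO 0 fun n => logGamma n ^ k := by
      induction k with
      | zero => simpa using LogPowO.const 1
      | succ k ih => simpa [pow_succ] using ih.mul logPowO_logGamma
    simpa using (h k).const_mul a

/-- Follows from 1/(n+1) ≤ log(1 + 1/n) ≤ 1/n. -/
theorem logPowO_logGamma_succ_sub :
    LogPowO 2 fun n => logGamma (n + 1) - logGamma n - 1 / (n : ℂ) := by
  refine LogPowO.of_bound 1 ?_
  filter_upwards [Filter.eventually_ge_atTop 1] with n hn
  have h1 : (0 : ℝ) < n := by exact_mod_cast hn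
  have e : logGamma (n + 1) - logGamma n - 1 / (n : ℂ) =
      ((Real.log (((n : ℝ) + 1) / n) - 1 / n : ℝ) : ℂ) := by
    rw [Real.log_div (by positivity) (by positivity)]
    simp [logGamma]
  rw [e, Complex.norm_real, Real.norm_eq_abs, abs_le, one_mul]
  have hl := Real.one_sub_inv_le_log_of_pos (x := ((n : ℝ) + 1) / n) (by positivity)
  have hu := Real.log_le_sub_one_of_pos (x := ((n : ℝ) + 1) / n) (by positivity)
  have e1 : ((n : ℝ) + 1) / n - 1 = 1 / n := by field_simp; ring
  have e2 : 1 - (((n : ℝ) + 1) / n)⁻¹ = 1 / (n + 1) := by field_simp; ring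
  have e3 : 1 / ((n : ℝ) + 1) - 1 / n = - (1 / (n * (n + 1))) := by field_simp; ring
  have e4 : 1 / ((n : ℝ) * (n + 1)) ≤ 1 / (n : ℝ) ^ 2 := by
    gcongr
    nlinarith
  have e5 : (0 : ℝ) ≤ 1 / (n : ℝ) ^ 2 := by positivity
  constructor <;> linarith

/-- A first-order Taylor expansion, obtained by building Q up through multiplication by X: the
discrete Leibniz rule carries the estimate along. -/
theorem logPowO_eval_succ_sub (Q : ℂ[X]) :
    LogPowO 2 fun n => Q.eval (logGamma (n + 1)) - Q.eval (logGamma n) -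
      Q.derivative.eval (logGamma n) / (n : ℂ) := by
  induction Q using Polynomial.induction_on with
  | C a => simpa using (LogPowO.const 0).mul (logPowO_inv_pow 2)
  | add p q hp hq =>
    refine (hp.add hq).congr' (Filter.Eventually.of_forall fun n => ?_)
    simp only [Polynomial.eval_add, Polynomial.derivative_add]
    ring
  | monomial k a ih =>
    rw [show Polynomial.C a * Polynomial.X ^ (k + 1) =
      Polynomial.C a * Polynomial.X ^ k * Polynomial.X by ring]
    generalize Polynomial.C a * Polynomial.X ^ k = Q at ih ⊢
    have hδ : LogPowO 1 fun n => logGamma (n + 1) - logGamma n := by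
      refine ((logPowO_logGamma_succ_sub.mono one_le_two).add logPowO_inv).congr'
        (Filter.Eventually.of_forall fun n => ?_)
      ring
    have hQ : LogPowO 1 fun n => Q.eval (logGamma (n + 1)) - Q.eval (logGamma n) := by
      refine ((ih.mono one_le_two).add
        ((logPowO_eval_logGamma Q.derivative).mul logPowO_inv)).congr'
        (Filter.Eventually.of_forall fun n => ?_)
      ring
    -- With x = `logGamma` and Δ the increment, Δ(Qx) - (Qx)'/n = (ΔQ - Q'/n)x + ΔQ Δx + Q(Δx -
    -- 1/n), and each term is of order 2.
    refine ((ih.mul logPowO_logGamma).add ((hQ.mul hδ).add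
      ((logPowO_eval_logGamma Q).mul logPowO_logGamma_succ_sub))).congr' ?_
    refine Filter.Eventually.of_forall fun n => ?_
    simp only [Polynomial.derivative_mul, Polynomial.derivative_X, Polynomial.eval_add,
      Polynomial.eval_mul, Polynomial.eval_X, Polynomial.eval_one]
    ring

theorem logPowO_eval_div_succ_sub (P : ℂ[X]) :
    LogPowO 2 fun n => P.eval (logGamma (n + 1)) / ((n : ℂ) + 1) -
      P.eval (logGamma n) / (n : ℂ) := by
  have hP : LogPowO 1 fun n => P.eval (logGamma (n + 1)) - P.eval (logGamma n) := by
    refine (((logPowO_eval_succ_sub P).mono one_le_two).add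
      ((logPowO_eval_logGamma P.derivative).mul logPowO_inv)).congr'
      (Filter.Eventually.of_forall fun n => ?_)
    ring
  refine ((hP.mul logPowO_inv_succ).add
    ((logPowO_eval_logGamma P).mul logPowO_inv_succ_sub_inv)).congr'
    (Filter.Eventually.of_forall fun n => ?_)
  ring

/-! ### Summation of sequences of size log^J n / n² -/

/-- Bounds the terms by a telescoping difference, so that tails of the series are bounded by log^J m
/ m. It is the mean value theorem for log^J x / x, whose derivative is (J log^{J-1} x - log^J x) /
x². -/
theorem log_pow_div_sq_le_sub (J : ℕ) : ∀ᶠ n : ℕ in Filter.atTop,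
    Real.log n ^ J / (n : ℝ) ^ 2 ≤
      8 * (Real.log n ^ J / (n : ℝ) - Real.log (n + 1 : ℕ) ^ J / ((n + 1 : ℕ) : ℝ)) := by
  filter_upwards [eventually_le_log (2 * J), eventually_le_log 1,
    Filter.eventually_ge_atTop 1] with n hJ h1 hn
  have hn0 : (1 : ℝ) ≤ n := by exact_mod_cast hn
  have hd (x : ℝ) (hx : 0 < x) : HasDerivAt (fun x : ℝ => Real.log x ^ J / x)
      ((J * Real.log x ^ (J - 1) * x⁻¹ * x - Real.log x ^ J * 1) / x ^ 2) x :=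
    ((Real.hasDerivAt_log hx.ne').fun_pow J).fun_div (hasDerivAt_id' x) hx.ne'
  obtain ⟨ξ, ⟨h2, h3⟩, h4⟩ := exists_hasDerivAt_eq_slope (fun x : ℝ => Real.log x ^ J / x) _
    (show (n : ℝ) < n + 1 by linarith)
    (fun x hx => (hd x (by linarith [hx.1])).continuousAt.continuousWithinAt)
    (fun x hx => hd x (by linarith [hx.1]))
  have hξ : 0 < ξ := by linarith
  have hlog : Real.log n ≤ Real.log ξ := Real.log_le_log (by linarith) h2.le
  rw [add_sub_cancel_left, div_one] at h4
  push_cast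
  -- The threshold log n ≥ 2J makes the negative part of the derivative at least twice the positive
  -- part; this costs a factor 2.
  have h5 : J * Real.log ξ ^ (J - 1) ≤ Real.log ξ ^ J / 2 := by
    rcases J with _ | J
    · simp
    · rw [Nat.add_sub_cancel, pow_succ]
      have : (0 : ℝ) ≤ Real.log ξ ^ J := pow_nonneg (by linarith) _
      nlinarith
  have h6 : Real.log n ^ J ≤ Real.log ξ ^ J := pow_le_pow_left₀ (by linarith) hlog J
  -- The factor 4 comes from ξ ≤ n + 1 ≤ 2n; together with the factor 2 it gives 8.
  have h7 : Real.log n ^ J / (n : ℝ) ^ 2 ≤ 4 * (Real.log ξ ^ J / ξ ^ 2) := by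
    rw [← mul_div_assoc, div_le_div_iff₀ (by positivity) (by positivity)]
    have : ξ ^ 2 ≤ 4 * (n : ℝ) ^ 2 := by nlinarith
    have h0 : (0 : ℝ) ≤ Real.log n ^ J := pow_nonneg (by linarith) _
    nlinarith [mul_le_mul h6 this (by positivity) (by linarith)]
  have h8 : (J * Real.log ξ ^ (J - 1) * ξ⁻¹ * ξ - Real.log ξ ^ J * 1) / ξ ^ 2 ≤
      -(Real.log ξ ^ J / ξ ^ 2) / 2 := by
    rw [inv_mul_cancel_right₀ hξ.ne', mul_one,
      show -(Real.log ξ ^ J / ξ ^ 2) / 2 = (-Real.log ξ ^ J / 2) / ξ ^ 2 by ring]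
    gcongr
    linarith
  linarith

/-- A sequence which is `O(log^J n / n²)` has a convergent sum, with remainder
`O(log^J m / m)`. -/
theorem LogPowO.exists_sum {b : ℕ → ℂ} (hb : LogPowO 2 b) :
    ∃ C : ℂ, LogPowO 1 fun m => ∑ n ∈ Finset.Ico 1 m, b n - C := by
  obtain ⟨J, hJ, hb⟩ := hb
  obtain ⟨K, hK, hb⟩ := hb.exists_pos
  set g : ℕ → ℝ := fun n => Real.log n ^ J / (n : ℝ) with hg
  obtain ⟨n₀, hn₀⟩ := Filter.eventually_atTop.1
    (hb.bound.and ((log_pow_div_sq_le_sub J).and (Filter.eventually_ge_atTop 1)))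
  have hg0 (n : ℕ) : 0 ≤ g n := by
    have := Real.log_natCast_nonneg n
    positivity
  have hle (m : ℕ) (hm : n₀ ≤ m) (M : ℕ) (hM : m ≤ M) :
      ‖∑ n ∈ Finset.Ico 1 M, b n - ∑ n ∈ Finset.Ico 1 m, b n‖ ≤ 8 * K * g m := by
    rw [← Finset.sum_Ico_consecutive _ (hn₀ m hm).2.2 hM, add_sub_cancel_left]
    refine (norm_sum_le_of_le (n := fun n => 8 * K * (g n - g (n + 1))) _
      fun n hn => ?_).trans ?_
    · obtain ⟨h1, h2, -⟩ := hn₀ n (hm.trans (Finset.mem_Ico.1 hn).1)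
      have := Real.log_natCast_nonneg n
      rw [Real.norm_of_nonneg (by positivity)] at h1
      calc ‖b n‖ ≤ _ := h1
        _ ≤ K * (8 * (g n - g (n + 1))) := by gcongr
        _ = _ := by ring
    · rw [← Finset.mul_sum]
      have : ∑ n ∈ Finset.Ico m M, (g n - g (n + 1)) = g m - g M := by
        induction M, hM using Nat.le_induction with
        | base => simp
        | succ M hM ih => rw [Finset.sum_Ico_succ_top hM, ih]; ring
      rw [this]
      have := hg0 M
      gcongr
      linarith
  have hgt : Filter.Tendsto g Filter.atTop (nhds 0) := by
    have := (Real.isLittleO_pow_log_id_atTop (n := J)).tendsto_div_nhds_zero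
    exact this.comp tendsto_natCast_atTop_atTop
  have hcau : CauchySeq fun m => ∑ n ∈ Finset.Ico 1 (m + n₀), b n := by
    refine cauchySeq_of_le_tendsto_0' (fun m => 8 * K * g (m + n₀)) (fun m M hM => ?_) ?_
    · rw [dist_comm, dist_eq_norm]
      exact hle _ (by omega) _ (by omega)
    · have := ((Filter.tendsto_add_atTop_iff_nat n₀).2 hgt).const_mul (8 * K)
      simpa using this
  obtain ⟨C, hC⟩ := cauchySeq_tendsto_of_complete hcau
  have hC' : Filter.Tendsto (fun m => ∑ n ∈ Finset.Ico 1 m, b n) Filter.atTop (nhds C) :=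
    (Filter.tendsto_add_atTop_iff_nat n₀).1 hC
  refine ⟨C, J, hJ, Asymptotics.IsBigO.of_bound (8 * K) ?_⟩
  filter_upwards [Filter.eventually_ge_atTop n₀] with m hm
  rw [pow_one, Real.norm_of_nonneg (hg0 m), norm_sub_rev]
  -- Let M tend to infinity in the tail bound `hle`.
  refine le_of_tendsto (hC'.sub_const _).norm ?_
  filter_upwards [Filter.eventually_ge_atTop m] with M hM
  exact hle m hm M hM

/-- If `a n` is close to the increment of `G`, then its sums are close to `G`. -/
theorem LogPowO.exists_sum_sub {a G : ℕ → ℂ} (h : LogPowO 2 fun n => a n - (G (n + 1) - G n)) :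
    ∃ C : ℂ, LogPowO 1 fun m => ∑ n ∈ Finset.Ico 1 m, a n - (G m + C) := by
  obtain ⟨C, hC⟩ := h.exists_sum
  -- The increments of G telescope from index 1.
  refine ⟨C - G 1, hC.congr' ?_⟩
  filter_upwards [Filter.eventually_ge_atTop 1] with m hm
  rw [Finset.sum_sub_distrib, Finset.sum_Ico_sub G hm]
  ring

/-! ### Harmonic regularization -/

theorem isHarmonicReg_iff {N : ℕ} (w : List (Letter N)) (P : ℂ[X]) :
    IsHarmonicReg w P ↔ LogPowO 1 fun m => truncL w m - P.eval (logGamma m) := by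
  simp only [IsHarmonicReg, LogPowO, pow_one, logGamma]

/-! ### Existence of the regularization polynomial -/

theorem norm_rootsIncl {N : ℕ} [NeZero N] (η : rootsOfUnity N ℂ) : ‖rootsIncl N η‖ = 1 := by
  refine Complex.norm_eq_one_of_pow_eq_one (n := N) ?_ (NeZero.ne N)
  rw [← map_pow, show η ^ N = 1 from Subtype.ext η.2, map_one]

theorem rootsIncl_injective {N : ℕ} : Function.Injective (rootsIncl N) :=
  Units.val_injective.comp Subtype.val_injective

theorem LogPowO.rootsIncl_pow_mul {N : ℕ} [NeZero N] {a : ℕ} {f : ℕ → ℂ} (hf : LogPowO a f)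
    (η : rootsOfUnity N ℂ) : LogPowO a fun n => rootsIncl N η ^ n * f n := by
  have h : LogPowO 0 fun n => rootsIncl N η ^ n :=
    LogPowO.of_bound 1 (Filter.Eventually.of_forall fun n => by simp [norm_rootsIncl])
  simpa using h.mul hf

theorem exists_derivative_eq (P : ℂ[X]) : ∃ Q : ℂ[X], Q.derivative = P := by
  induction P using Polynomial.induction_on' with
  | add p q hp hq =>
    obtain ⟨p', rfl⟩ := hp
    obtain ⟨q', rfl⟩ := hq
    exact ⟨p' + q', Polynomial.derivative_add⟩
  | monomial k a =>
    refine ⟨Polynomial.monomial (k + 1) (a / (k + 1)), ?_⟩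
    have : (k : ℂ) + 1 ≠ 0 := by exact_mod_cast k.succ_ne_zero
    rw [Polynomial.derivative_monomial, Nat.add_sub_cancel, Nat.cast_succ,
      div_mul_cancel₀ _ this]

/-- Finds an approximate discrete primitive of the summand: a polynomial part Q and a negligible
part E. For e_{1,1} an antiderivative of P works; for k = 1 and η ≠ 1 summation by parts leaves only
an oscillating E; for k ≥ 2 the summand is itself of order 2. The formula for Q' later gives the
derivative of L_*. -/
theorem exists_increment {N : ℕ} [NeZero N] (a : Letter N) (P : ℂ[X]) :
    ∃ (Q : ℂ[X]) (E : ℕ → ℂ), Q.derivative = (if a = (1, 1) then P else 0) ∧ LogPowO 1 E ∧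
      LogPowO 2 fun n => rootsIncl N a.2 ^ n / (n : ℂ) ^ (a.1 : ℕ) * P.eval (logGamma n) -
        ((Q.eval (logGamma (n + 1)) + E (n + 1)) - (Q.eval (logGamma n) + E n)) := by
  obtain ⟨k, η⟩ := a
  have h0 : LogPowO 1 fun _ => 0 := by simpa using (LogPowO.const 0).mul logPowO_inv
  by_cases hk : k = 1
  · subst hk
    by_cases hη : η = 1
    · subst hη
      obtain ⟨Q, rfl⟩ := exists_derivative_eq P
      refine ⟨Q, fun _ => 0, by simp, h0, (logPowO_eval_succ_sub Q).neg.congr'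
        (Filter.Eventually.of_forall fun n => ?_)⟩
      simp only [map_one, one_pow, PNat.one_coe, pow_one]
      ring
    · have hz : rootsIncl N η - 1 ≠ 0 := by
        rw [sub_ne_zero]
        intro h
        exact hη (rootsIncl_injective (h.trans (map_one _).symm))
      -- The sequence z^n has discrete primitive z^n / (z - 1); it is multiplied by the slowly
      -- varying P / n.
      refine ⟨0, fun n => rootsIncl N η ^ n *
        ((rootsIncl N η - 1)⁻¹ * (P.eval (logGamma n) / (n : ℂ))), ?_, ?_, ?_⟩
      · simp [hη]
      · refine LogPowO.rootsIncl_pow_mul (LogPowO.const_mul ?_ _) η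
        simpa [div_eq_mul_inv] using (logPowO_eval_logGamma P).mul logPowO_inv
      -- The defect of this primitive is -z^{n+1} / (z - 1) times the increment of P / n.
      · refine (((logPowO_eval_div_succ_sub P).const_mul
          (-(rootsIncl N η * (rootsIncl N η - 1)⁻¹))).rootsIncl_pow_mul η).congr'
          (Filter.Eventually.of_forall fun n => ?_)
        simp only [PNat.one_coe, pow_one, Polynomial.eval_zero, Nat.cast_succ]
        generalize rootsIncl N η = z at hz ⊢
        generalize Polynomial.eval (logGamma (n + 1)) P / ((n : ℂ) + 1) = u
        rw [div_mul_eq_mul_div, mul_div_assoc]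
        generalize Polynomial.eval (logGamma n) P / (n : ℂ) = v
        rw [pow_succ]
        field_simp
        ring
  · have hk2 : 2 ≤ (k : ℕ) := by
      have h1 := k.pos
      have h2 : (k : ℕ) ≠ 1 := fun h => hk (PNat.coe_eq_one_iff.1 h)
      omega
    refine ⟨0, fun _ => 0, by simp [hk], h0, ?_⟩
    have := (((logPowO_inv_pow (k : ℕ)).mul (logPowO_eval_logGamma P)).mono
      hk2).rootsIncl_pow_mul η
    refine this.congr' (Filter.Eventually.of_forall fun n => ?_)
    simp only [Polynomial.eval_zero]
    ring

theorem IsHarmonicReg.exists_cons {N : ℕ} [NeZero N] {w : List (Letter N)} {P : ℂ[X]}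
    (h : IsHarmonicReg w P) (a : Letter N) :
    ∃ Q : ℂ[X], IsHarmonicReg (a :: w) Q ∧
      Q.derivative = if a = (1, 1) then P else 0 := by
  rw [isHarmonicReg_iff] at h
  obtain ⟨Q, E, hQ, hE, hinc⟩ := exists_increment a P
  -- Replacing `truncL w n` by its polynomial costs O(log^J n / n); the factor 1 / n^k with k ≥ 1
  -- raises this to order 2.
  have hrest : LogPowO 2 fun n => rootsIncl N a.2 ^ n *
      (1 / (n : ℂ) ^ (a.1 : ℕ) * (truncL w n - P.eval (logGamma n))) :=
    (((logPowO_inv_pow _).mul h).mono (by have := a.1.pos; omega)).rootsIncl_pow_mul a.2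
  obtain ⟨C, hC⟩ := LogPowO.exists_sum_sub
    (a := fun n => rootsIncl N a.2 ^ n / (n : ℂ) ^ (a.1 : ℕ) * truncL w n)
    (G := fun n => Q.eval (logGamma n) + E n)
    ((hinc.add hrest).congr' (Filter.Eventually.of_forall fun n => by ring))
  refine ⟨Q + Polynomial.C C, ?_, by simp [hQ]⟩
  rw [isHarmonicReg_iff]
  refine (hC.add hE).congr' (Filter.Eventually.of_forall fun m => ?_)
  simp only [truncL, truncSum, Polynomial.eval_add, Polynomial.eval_C]
  ring

theorem isHarmonicReg_nil {N : ℕ} : IsHarmonicReg ([] : List (Letter N)) 1 := by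
  rw [isHarmonicReg_iff]
  simpa [truncL, truncSum] using (LogPowO.const 0).mul logPowO_inv

theorem exists_isHarmonicReg {N : ℕ} [NeZero N] (w : List (Letter N)) :
    ∃ P, IsHarmonicReg w P := by
  induction w with
  | nil => exact ⟨1, isHarmonicReg_nil⟩
  | cons a w ih =>
    obtain ⟨P, hP⟩ := ih
    obtain ⟨Q, hQ, -⟩ := hP.exists_cons a
    exact ⟨Q, hQ⟩

/-! ### Uniqueness and multiplicativity of the regularization -/

theorem LogPowO.tendsto_zero {f : ℕ → ℂ} (h : LogPowO 1 f) :
    Filter.Tendsto f Filter.atTop (nhds 0) := by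
  obtain ⟨J, -, h⟩ := h
  refine h.trans_tendsto ?_
  simp only [pow_one]
  exact (Real.isLittleO_pow_log_id_atTop (n := J)).tendsto_div_nhds_zero.comp
    tendsto_natCast_atTop_atTop

theorem tendsto_norm_logGamma :
    Filter.Tendsto (fun n => ‖logGamma n‖) Filter.atTop Filter.atTop := by
  simp only [logGamma, Complex.norm_real]
  exact tendsto_norm_atTop_atTop.comp (Filter.tendsto_atTop_add_const_right _ _
    (Real.tendsto_log_atTop.comp tendsto_natCast_atTop_atTop))

/-- A nonconstant polynomial is unbounded along `logGamma`, whose norm tends to infinity; a constant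
that tends to 0 is 0. -/
theorem eq_zero_of_logPowO_eval {P : ℂ[X]} (h : LogPowO 1 fun n => P.eval (logGamma n)) :
    P = 0 := by
  by_cases hd : 0 < P.degree
  · exact absurd h.tendsto_zero.norm
      (Filter.Tendsto.not_tendsto (P.tendsto_norm_atTop hd tendsto_norm_logGamma)
        (disjoint_nhds_atTop _).symm)
  · rw [Polynomial.eq_C_of_degree_le_zero (not_lt.1 hd)] at h ⊢
    simp only [Polynomial.eval_C] at h
    rw [tendsto_nhds_unique tendsto_const_nhds h.tendsto_zero, Polynomial.C_0]

theorem IsHarmonicReg.unique {N : ℕ} {w : List (Letter N)} {P Q : ℂ[X]}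
    (hP : IsHarmonicReg w P) (hQ : IsHarmonicReg w Q) : P = Q := by
  rw [isHarmonicReg_iff] at hP hQ
  refine sub_eq_zero.1 (eq_zero_of_logPowO_eval ((hQ.sub hP).congr'
    (Filter.Eventually.of_forall fun n => ?_)))
  simp only [Polynomial.eval_sub]
  ring

theorem isHarmonicReg_regL {N : ℕ} [NeZero N] (w : List (Letter N)) :
    IsHarmonicReg w (regL w) :=
  Classical.epsilon_spec (exists_isHarmonicReg w)

theorem regL_nil {N : ℕ} [NeZero N] : regL ([] : List (Letter N)) = 1 :=
  (isHarmonicReg_regL _).unique isHarmonicReg_nil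

theorem derivative_regL_cons {N : ℕ} [NeZero N] (a : Letter N) (w : List (Letter N)) :
    (regL (a :: w)).derivative = if a = (1, 1) then regL w else 0 := by
  obtain ⟨Q, hQ, hd⟩ := (isHarmonicReg_regL w).exists_cons a
  rw [(isHarmonicReg_regL (a :: w)).unique hQ, hd]

theorem logPowO_sum_regL {N : ℕ} [NeZero N] (l : List (List (Letter N))) :
    LogPowO 1 fun m => (l.map fun v => truncL v m).sum -
      (l.map regL).sum.eval (logGamma m) := by
  induction l with
  | nil => simpa using (LogPowO.const 0).mul logPowO_inv
  | cons v l ih =>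
    refine (((isHarmonicReg_iff _ _).1 (isHarmonicReg_regL v)).add ih).congr'
      (Filter.Eventually.of_forall fun m => ?_)
    simp only [List.map_cons, List.sum_cons, Polynomial.eval_add]
    ring

/-- The truncated sums satisfy the identity for every m, and both sides approximate them up to
O(log^J m / m), so their difference is zero. -/
theorem regL_mul {N : ℕ} [NeZero N] (w w' : List (Letter N)) :
    regL w * regL w' = ((stuffleList w w').map regL).sum := by
  have h := (isHarmonicReg_iff _ _).1 (isHarmonicReg_regL w)
  have h' := (isHarmonicReg_iff _ _).1 (isHarmonicReg_regL w')
  have hT : LogPowO 0 fun m => truncL w m := by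
    refine ((h.mono zero_le_one).add (logPowO_eval_logGamma (regL w))).congr'
      (Filter.Eventually.of_forall fun m => ?_)
    ring
  have hL := logPowO_sum_regL (stuffleList w w')
  refine sub_eq_zero.1 (eq_zero_of_logPowO_eval ((hL.sub ((hT.mul h').add
    ((logPowO_eval_logGamma (regL w')).mul h))).congr'
    (Filter.Eventually.of_forall fun m => ?_)))
  have := truncSum_mul (rootsIncl N) m w w'
  simp only [truncL, Polynomial.eval_sub, Polynomial.eval_mul] at this ⊢
  rw [← this]
  ring

/-- Harmonic regularization as a homomorphism of algebras. -/
def regHom (N : ℕ) [NeZero N] : HarmonicAlgebra N →ₐ[ℚ] ℂ[X] :=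
  algHomOfWords regL regL_nil regL_mul

theorem regHom_word {N : ℕ} [NeZero N] (w : List (Letter N)) :
    regHom N (HarmonicAlgebra.word w) = regL w :=
  algHomOfWords_word _ _ _ w

namespace HarmonicAlgebra

variable {N : ℕ}

/-! ### Reversal of words -/

/-- Right concatenation with a letter. -/
def snoc (a : Letter N) : HarmonicAlgebra N →ₗ[ℚ] HarmonicAlgebra N :=
  lift (fun w => word (w ++ [a]))

theorem snoc_word (a : Letter N) (w : List (Letter N)) : snoc a (word w) = word (w ++ [a]) :=
  lift_word _ _

theorem snoc_cons (a b : Letter N) (p : HarmonicAlgebra N) :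
    snoc a (cons b p) = cons b (snoc a p) := by
  have h : snoc a ∘ₗ cons b = cons b ∘ₗ snoc a := hom_ext fun w => by
    simp only [LinearMap.comp_apply, cons_word, snoc_word, List.cons_append]
  exact LinearMap.congr_fun h p

theorem snoc_one (a : Letter N) : snoc a (1 : HarmonicAlgebra N) = cons a 1 := by
  rw [one_def, snoc_word, cons_word, List.nil_append]

/-- The harmonic product satisfies the same recursion from the right, which is why reversal is
multiplicative. The induction strips letters from the left, where `cons` commutes with `snoc`. -/
theorem snoc_word_mul_snoc_word (a b : Letter N) (u v : List (Letter N)) :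
    snoc a (word u) * snoc b (word v) =
      snoc a (word u * snoc b (word v)) + snoc b (snoc a (word u) * word v) +
        snoc (a.merge b) (word u * word v) := by
  have nil_left (a b : Letter N) (v : List (Letter N)) :
      snoc a 1 * snoc b (word v) =
        snoc a (snoc b (word v)) + snoc b (snoc a 1 * word v) + snoc (a.merge b) (word v) := by
    induction v with
    | nil =>
      rw [← one_def]
      simp only [snoc_one, snoc_cons, cons_mul_cons, one_mul, mul_one]
      abel
    | cons d v ih =>
      rw [snoc_one] at ih
      rw [← cons_word]
      simp only [snoc_one, snoc_cons, cons_mul_cons, one_mul, ih, map_add]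
      abel
  induction u generalizing v with
  | nil => rw [← one_def, nil_left, one_mul, one_mul]
  | cons c u ihu =>
    induction v with
    | nil =>
      -- Commutativity reduces an empty second word to `nil_left`.
      rw [← one_def, mul_comm, nil_left, mul_one, mul_one, mul_comm (snoc b 1), merge_comm]
      abel
    | cons d v ihv =>
      have h1 := ihu (d :: v)
      have h2 := ihu v
      rw [← cons_word] at h1 ihv
      rw [← cons_word, ← cons_word]
      simp only [snoc_cons] at h1 ihv ⊢
      rw [cons_mul_cons, h1, ihv, h2, cons_mul_cons c d, cons_mul_cons c d, cons_mul_cons c d]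
      simp only [map_add, snoc_cons]
      abel

theorem snoc_mul_snoc (a b : Letter N) (p q : HarmonicAlgebra N) :
    snoc a p * snoc b q =
      snoc a (p * snoc b q) + snoc b (snoc a p * q) + snoc (a.merge b) (p * q) := by
  refine induction_words p ?_ (fun p p' hp hp' => ?_) (fun c p hp => ?_) (fun w => ?_)
  · simp only [map_zero, zero_mul, add_zero]
  · simp only [map_add, add_mul, hp, hp']
    abel
  · simp only [map_smul, smul_mul_assoc, hp, smul_add]
  refine induction_words q ?_ (fun p p' hp hp' => ?_) (fun c p hp => ?_) (fun w' => ?_)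
  · simp only [map_zero, mul_zero, add_zero]
  · simp only [map_add, mul_add, hp, hp']
    abel
  · simp only [map_smul, mul_smul_comm, hp, smul_add]
  · exact snoc_word_mul_snoc_word a b w w'

theorem revConj_cons (a : Letter N) (w : List (Letter N)) :
    revConj (a :: w) = revConj w ++ [(a.1, a.2⁻¹)] := by
  simp [revConj]

theorem revConj_append_singleton (a : Letter N) (w : List (Letter N)) :
    revConj (w ++ [a]) = (a.1, a.2⁻¹) :: revConj w := by
  simp [revConj]

/-- The operators T play the role of `cons` in M, so both sides obey the same recursion. -/
theorem map_word_mul_word_of_recursion {M : Type} [CommRing M] [Algebra ℚ M]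
    (F : HarmonicAlgebra N →ₗ[ℚ] M) (T : Letter N → M →ₗ[ℚ] M) (h1 : F 1 = 1)
    (hc : ∀ a p, F (cons a p) = T a (F p))
    (hT : ∀ a b p q, T a (F p) * T b (F q) =
      T a (F p * T b (F q)) + T b (T a (F p) * F q) + T (a.merge b) (F p * F q))
    (u v : List (Letter N)) : F (word u * word v) = F (word u) * F (word v) := by
  induction u generalizing v with
  | nil => rw [← one_def, h1, one_mul, one_mul]
  | cons a u ihu =>
    induction v with
    | nil => rw [← one_def, h1, mul_one, mul_one]
    | cons b v ihv =>
      have h2 := ihu (b :: v)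
      have h3 := ihu v
      simp only [← cons_word] at h2 ihv ⊢
      rw [cons_mul_cons, map_add, map_add, hc, hc, hc, h2, ihv, h3]
      simp only [hc]
      rw [hT]

/-- A linear map on the harmonic algebra which satisfies the recursion of the harmonic product
is a homomorphism of algebras. -/
def algHomOfRecursion {M : Type} [CommRing M] [Algebra ℚ M]
    (F : HarmonicAlgebra N →ₗ[ℚ] M) (T : Letter N → M →ₗ[ℚ] M) (h1 : F 1 = 1)
    (hc : ∀ a p, F (cons a p) = T a (F p))
    (hT : ∀ a b p q, T a (F p) * T b (F q) =
      T a (F p * T b (F q)) + T b (T a (F p) * F q) + T (a.merge b) (F p * F q)) :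
    HarmonicAlgebra N →ₐ[ℚ] M :=
  AlgHom.ofLinearMap F h1
    (map_mul_of_map_word_mul_word F (map_word_mul_word_of_recursion F T h1 hc hT))

/-- Reversal of words combined with complex conjugation of the roots of unity, as a homomorphism
of algebras. -/
def revConjHom (N : ℕ) : HarmonicAlgebra N →ₐ[ℚ] HarmonicAlgebra N :=
  algHomOfRecursion (lift fun w => word (revConj w)) (fun a => snoc (a.1, a.2⁻¹))
    (by rw [one_def, lift_word]; rfl)
    (by
      intro a p
      have h : (lift fun w => word (revConj w)) ∘ₗ cons a =
          snoc (a.1, a.2⁻¹) ∘ₗ lift fun w => word (revConj w) := hom_ext fun w => by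
        simp only [LinearMap.comp_apply, cons_word, lift_word, snoc_word, revConj_cons]
      exact LinearMap.congr_fun h p)
    (by
      intro a b p q
      rw [snoc_mul_snoc]
      simp only [Letter.merge, mul_inv])

theorem revConjHom_word (w : List (Letter N)) : revConjHom N (word w) = word (revConj w) :=
  lift_word _ w

/-! ### Deconcatenation -/

open scoped TensorProduct

/-- The deconcatenation of a word. -/
def deconcatWord (w : List (Letter N)) : HarmonicAlgebra N ⊗[ℚ] HarmonicAlgebra N :=
  ∑ j ∈ Finset.range (w.length + 1), word (w.take j) ⊗ₜ word (w.drop j)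

/-- The deconcatenation coproduct, as a linear map. -/
def deconcatLinear (N : ℕ) : HarmonicAlgebra N →ₗ[ℚ] HarmonicAlgebra N ⊗[ℚ] HarmonicAlgebra N :=
  lift deconcatWord

/-- A prefix of a word starting with a is either empty or starts with a. -/
theorem deconcatLinear_cons (a : Letter N) (p : HarmonicAlgebra N) :
    deconcatLinear N (cons a p) =
      1 ⊗ₜ cons a p + (cons a).rTensor (HarmonicAlgebra N) (deconcatLinear N p) := by
  refine induction_words p (by simp) (fun p q hp hq => ?_) (fun c p hp => ?_) (fun w => ?_)
  · simp only [map_add, hp, hq, TensorProduct.tmul_add]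
    abel
  · simp only [map_smul, hp, TensorProduct.tmul_smul, smul_add]
  · rw [cons_word, deconcatLinear, lift_word, lift_word, deconcatWord, deconcatWord, map_sum,
      List.length_cons, Finset.sum_range_succ', add_comm]
    simp only [List.take_zero, List.drop_zero, List.take_succ_cons, List.drop_succ_cons,
      LinearMap.rTensor_tmul, cons_word, one_def]

theorem rTensor_cons_mul_rTensor_cons (a b : Letter N)
    (x y : HarmonicAlgebra N ⊗[ℚ] HarmonicAlgebra N) :
    (cons a).rTensor _ x * (cons b).rTensor _ y =
      (cons a).rTensor _ (x * (cons b).rTensor _ y) +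
        (cons b).rTensor _ ((cons a).rTensor _ x * y) +
        (cons (a.merge b)).rTensor _ (x * y) := by
  induction x using TensorProduct.induction_on with
  | zero => simp
  | add x x' hx hx' =>
    simp only [map_add, add_mul, hx, hx']
    abel
  | tmul p q =>
    induction y using TensorProduct.induction_on with
    | zero => simp
    | add y y' hy hy' =>
      simp only [map_add, mul_add, hy, hy']
      abel
    | tmul p' q' =>
      simp only [LinearMap.rTensor_tmul, Algebra.TensorProduct.tmul_mul_tmul, cons_mul_cons,
        TensorProduct.add_tmul]

theorem rTensor_mul_one_tmul (a : Letter N) (x : HarmonicAlgebra N ⊗[ℚ] HarmonicAlgebra N)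
    (q : HarmonicAlgebra N) :
    (cons a).rTensor _ x * (1 ⊗ₜ q) = (cons a).rTensor _ (x * (1 ⊗ₜ q)) := by
  induction x using TensorProduct.induction_on with
  | zero => simp
  | add x x' hx hx' => simp only [map_add, add_mul, hx, hx']
  | tmul p p' =>
    simp only [LinearMap.rTensor_tmul, Algebra.TensorProduct.tmul_mul_tmul, mul_one]

theorem one_tmul_mul_rTensor (a : Letter N) (x : HarmonicAlgebra N ⊗[ℚ] HarmonicAlgebra N)
    (q : HarmonicAlgebra N) :
    (1 ⊗ₜ q) * (cons a).rTensor _ x = (cons a).rTensor _ ((1 ⊗ₜ q) * x) := by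
  rw [mul_comm, rTensor_mul_one_tmul, mul_comm]

/-- By `deconcatLinear_cons` each factor has a part with empty prefix and a part with prefix
starting with its first letter. The product of the empty-prefix parts follows the recursion in the
second tensor slot; the product of the other two follows it in the first, and the mixed products
have only one candidate first letter. -/
theorem deconcatLinear_word_mul_word (u v : List (Letter N)) :
    deconcatLinear N (word u * word v) =
      deconcatLinear N (word u) * deconcatLinear N (word v) := by
  have h1 : deconcatLinear N 1 = 1 := by
    rw [one_def, deconcatLinear, lift_word]
    simp [deconcatWord, ← one_def, Algebra.TensorProduct.one_def]
  induction u generalizing v with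
  | nil => rw [← one_def, h1, one_mul, one_mul]
  | cons a u ihu =>
    induction v with
    | nil => rw [← one_def, h1, mul_one, mul_one]
    | cons b v ihv =>
      have h2 := ihu (b :: v)
      have h3 := ihu v
      simp only [← cons_word] at h2 ihv ⊢
      rw [cons_mul_cons, map_add, map_add]
      simp only [deconcatLinear_cons] at h2 ihv ⊢
      rw [h2, h3, ihv]
      simp only [add_mul, mul_add, map_add, rTensor_cons_mul_rTensor_cons, rTensor_mul_one_tmul,
        one_tmul_mul_rTensor, Algebra.TensorProduct.tmul_mul_tmul, one_mul, cons_mul_cons,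
        TensorProduct.tmul_add]
      abel

/-- The deconcatenation coproduct is a homomorphism of algebras for the harmonic product. -/
def deconcat (N : ℕ) : HarmonicAlgebra N →ₐ[ℚ] HarmonicAlgebra N ⊗[ℚ] HarmonicAlgebra N :=
  AlgHom.ofLinearMap (deconcatLinear N)
    (by
      rw [one_def, deconcatLinear, lift_word]
      simp [deconcatWord, ← one_def, Algebra.TensorProduct.one_def])
    (map_mul_of_map_word_mul_word _ deconcatLinear_word_mul_word)

theorem deconcat_word (w : List (Letter N)) : deconcat N (word w) = deconcatWord w :=
  lift_word _ w

end HarmonicAlgebra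

/-! ### Symmetric colored multiple zeta values -/

/-- The sign `(-1)^k` times `η^α`, attached to the letter `e_{k,η}`. -/
def symSign {N : ℕ} (α : ZMod N) (a : Letter N) : ℂ :=
  (-1) ^ (a.1 : ℕ) * rootsIncl N a.2 ^ α.val

theorem symSign_merge {N : ℕ} (α : ZMod N) (a b : Letter N) :
    symSign α (a.merge b) = symSign α a * symSign α b := by
  simp only [symSign, Letter.merge, PNat.add_coe, map_mul, pow_add, mul_pow]
  ring

theorem prod_map_symSign {N : ℕ} (α : ZMod N) (w : List (Letter N)) :
    (w.map (symSign α)).prod = (-1) ^ weight w * rootsIncl N (colorProd w) ^ α.val := by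
  induction w with
  | nil => simp [weight, colorProd]
  | cons a w ih =>
    simp only [weight, colorProd, List.map_cons, List.sum_cons, List.prod_cons, map_mul,
      pow_add, mul_pow] at ih ⊢
    rw [ih, symSign]
    ring

/-- The first factor of the symmetric values, on words. -/
def symLeft {N : ℕ} (α : ZMod N) (s : ℂ[X]) (w : List (Letter N)) : ℂ[X] :=
  Polynomial.C (w.map (symSign α)).prod * (regL (revConj w)).comp s

/-- Substitution in polynomials over `ℂ`, as a homomorphism of `ℚ`-algebras. -/
def substHom (s : ℂ[X]) : ℂ[X] →ₐ[ℚ] ℂ[X] :=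
  (Polynomial.aeval s : ℂ[X] →ₐ[ℂ] ℂ[X]).restrictScalars ℚ

theorem substHom_apply (s P : ℂ[X]) : substHom s P = P.comp s :=
  rfl

theorem symLeft_mul {N : ℕ} [NeZero N] (α : ZMod N) (s : ℂ[X]) (w w' : List (Letter N)) :
    symLeft α s w * symLeft α s w' = ((stuffleList w w').map (symLeft α s)).sum := by
  have h := algHom_word_mul ((substHom s).comp ((regHom N).comp
    (HarmonicAlgebra.revConjHom N))) w w'
  simp only [AlgHom.comp_apply, HarmonicAlgebra.revConjHom_word, regHom_word,
    substHom_apply] at h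
  rw [symLeft, symLeft, mul_mul_mul_comm, h, ← Polynomial.C_mul, ← List.sum_map_mul_left]
  congr 1
  -- The twist takes the same value on all words of the product.
  refine List.map_congr_left fun v hv => ?_
  rw [symLeft, eq_mul_of_mem_stuffleList _ (symSign_merge α) w w' v hv]

/-- The first factor of the symmetric values, as a homomorphism of algebras. -/
def symLeftHom {N : ℕ} [NeZero N] (α : ZMod N) (s : ℂ[X]) : HarmonicAlgebra N →ₐ[ℚ] ℂ[X] :=
  algHomOfWords (symLeft α s) (by simp [symLeft, revConj, regL_nil]) (symLeft_mul α s)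

/-- The symmetric values, as a homomorphism of algebras with values in polynomials. -/
def symHom {N : ℕ} [NeZero N] (α : ZMod N) : HarmonicAlgebra N →ₐ[ℚ] ℂ[X] :=
  (Algebra.TensorProduct.productMap
    (symLeftHom α (Polynomial.X + Polynomial.C ((Real.pi : ℂ) * Complex.I / 2)))
    ((substHom (Polynomial.X - Polynomial.C ((Real.pi : ℂ) * Complex.I / 2))).comp
      (regHom N))).comp (HarmonicAlgebra.deconcat N)

theorem symHom_word {N : ℕ} [NeZero N] (α : ZMod N) (w : List (Letter N)) :
    symHom α (HarmonicAlgebra.word w) = symL α w := by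
  rw [symHom, AlgHom.comp_apply, HarmonicAlgebra.deconcat_word, HarmonicAlgebra.deconcatWord,
    map_sum, symL]
  refine Finset.sum_congr rfl fun j _ => ?_
  rw [Algebra.TensorProduct.productMap_apply_tmul, AlgHom.comp_apply, regHom_word, symLeftHom,
    algHomOfWords_word, substHom_apply, symLeft, prod_map_symSign]

theorem derivative_symLeft_nil {N : ℕ} [NeZero N] (α : ZMod N) (s : ℂ[X]) :
    (symLeft α s []).derivative = 0 := by
  simp [symLeft, revConj, regL_nil]

/-- Reversal brings the last letter of the prefix to the front, where differentiation removes it;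
the minus sign is `symSign` of e_{1,1}. -/
theorem derivative_symLeft_append {N : ℕ} [NeZero N] (α : ZMod N) (s : ℂ[X])
    (hs : s.derivative = 1) (w : List (Letter N)) (a : Letter N) :
    (symLeft α s (w ++ [a])).derivative = if a = (1, 1) then -symLeft α s w else 0 := by
  have ha : ((a.1, a.2⁻¹) : Letter N) = (1, 1) ↔ a = (1, 1) := by
    simp [Prod.ext_iff]
  rw [symLeft, HarmonicAlgebra.revConj_append_singleton, Polynomial.derivative_mul,
    Polynomial.derivative_C, zero_mul, zero_add, Polynomial.derivative_comp, hs, one_mul,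
    derivative_regL_cons]
  simp only [ha]
  split_ifs with h
  · subst h
    simp [symLeft, symSign]
  · simp

theorem derivative_symL {N : ℕ} [NeZero N] (α : ZMod N) (w : List (Letter N)) :
    (symL α w).derivative = 0 := by
  set s : ℂ[X] := Polynomial.X + Polynomial.C ((Real.pi : ℂ) * Complex.I / 2) with hs
  set t : ℂ[X] := Polynomial.X - Polynomial.C ((Real.pi : ℂ) * Complex.I / 2) with ht
  have hs1 : s.derivative = 1 := by simp [hs]
  have ht1 : t.derivative = 1 := by simp [ht]
  have h : symL α w = ∑ j ∈ Finset.range (w.length + 1),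
      symLeft α s (w.take j) * (regL (w.drop j)).comp t :=
    Finset.sum_congr rfl fun j _ => by rw [symLeft, prod_map_symSign]
  rw [h, Polynomial.derivative_sum]
  simp only [Polynomial.derivative_mul]
  -- The left derivative at j = 0 and the right one at j = r vanish. After a shift by one, the left
  -- derivative at cut j + 1 is paired with the right derivative at cut j: both remove the letter
  -- between the two cuts.
  rw [Finset.sum_add_distrib, Finset.sum_range_succ', Finset.sum_range_succ (fun j =>
    symLeft α s (w.take j) * ((regL (w.drop j)).comp t).derivative), List.take_zero,
    derivative_symLeft_nil, List.drop_length, regL_nil, Polynomial.one_comp,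
    Polynomial.derivative_one, zero_mul, mul_zero, add_zero, add_zero, ← Finset.sum_add_distrib]
  refine Finset.sum_eq_zero fun j hj => ?_
  have hj : j < w.length := Finset.mem_range.1 hj
  rw [List.drop_eq_getElem_cons hj, ← List.take_append_getElem hj,
    derivative_symLeft_append α s hs1, Polynomial.derivative_comp, ht1, derivative_regL_cons]
  split_ifs <;> simp

/-- The symmetric values, as a homomorphism of algebras with values in `ℂ`. -/
def symValueHom {N : ℕ} [NeZero N] (α : ZMod N) : HarmonicAlgebra N →ₐ[ℚ] ℂ :=
  ((Polynomial.aeval (0 : ℂ) : ℂ[X] →ₐ[ℂ] ℂ).restrictScalars ℚ).comp (symHom α)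

theorem C_symValueHom_word {N : ℕ} [NeZero N] (α : ZMod N) (w : List (Letter N)) :
    Polynomial.C (symValueHom α (HarmonicAlgebra.word w)) = symL α w := by
  have h := Polynomial.eq_C_of_derivative_eq_zero (derivative_symL α w)
  rw [symValueHom, AlgHom.comp_apply, symHom_word, h]
  simp

end CMZV

end

theorem mainTheorem6 (N : ℕ) [NeZero N] (α : ZMod N)
    (c : ∀ p : CMZV.primesInClass N α, CMZV.ResidueChoice N (p : ℕ)) :
    (∃ f : CMZV.HarmonicAlgebra N →ₐ[ℚ] ℂ, ∀ w : List (CMZV.Letter N),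
      Polynomial.C (f (CMZV.HarmonicAlgebra.word w)) = CMZV.symL α w) ∧
    (∃ g : CMZV.HarmonicAlgebra N →ₐ[ℚ] CMZV.FiniteRing N α, ∀ w : List (CMZV.Letter N),
      g (CMZV.HarmonicAlgebra.word w) = CMZV.finL c w) :=
  ⟨⟨CMZV.symValueHom α, CMZV.C_symValueHom_word α⟩,
    ⟨CMZV.algHomOfWords (CMZV.finL c) (CMZV.finL_nil c) (CMZV.finL_mul c),
      CMZV.algHomOfWords_word _ _ _⟩⟩
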